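/- Let $X=\ell_\infty(\mathbb N)$ be the Banach space of bounded real sequences with the supremum norm, $\bar{\mathbf B}$ its closed unit ball, and $c_0=c_0(\mathbb N)\subset X$ the subspace of sequences converging to $0$. For a closed set $S\subset X$ and $x_0\in S$: - the Clarke tangent cone $\hat T_S(x_0)$ is the set of all $v\in X$ such that for each $\varepsilon>0$ there exist $\delta>0$ and $\lambda>0$ such that $S\cap(x+t(v+\varepsilon\bar{\mathbf B}))\ne\emptyset$ for all $x\in S\cap(x_0+\delta\bar{\mathbf B})$ and all $t\in[0,\lambda]$; - the Clarke normal cone is $N_S(x_0)=\{x^*\in X^* : \langle x^*,v\rangle\le 0 \text{ for all } v\in\hat T_S(x_0)\}$; - $S$ is compactly epi-Lipschitz at $x_0$ if there exist $\varepsilon>0$, $\delta>0$ and a compact set $K\subset X$ such that for all $x\in S\cap(x_0+\delta\bar{\mathbf B})$, all $v\in X$ with $\|v\|\le\varepsilon$ and all $t\in[0,\delta]$ there is $k\in K$ with $x+t(v-k)\in S$. Two closed convex cones $C_1,C_2\subset X$ are called transversal if there is $\rho>0$ with $\rho\bar{\mathbf B}\subset\overline{(C_1\cap\bar{\mathbf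 B})-(C_2\cap\bar{\mathbf B})}$. Let $A=\{x\in X : \liminf_{n\to\infty}|x_n|\le 0\}$. Then: 1. $A$ is closed, $0\in A$, $A$ is compactly epi-Lipschitz at $0$, and $\hat T_A(0)=c_0$. 2. There exists a closed linear subspace $B$ of $X$ such that $c_0+B$ is dense in $X$ but $c_0+B\ne X$. 3. For every closed linear subspace $B$ as in 2, one has $\hat T_B(0)=B$ and $\hat T_A(0)-\hat T_B(0)=c_0+B\subsetneq X$, $\overline{\hat T_A(0)-\hat T_B(0)}=X$, the cones $\hat T_A(0)$ and $\hat T_B(0)$ are not transversal, and $N_A(0)+N_B(0)$ is not weak$^*$-closed in $X^*$. -/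

import Mathlib

open Filter Topology Metric
open scoped Pointwise

/-- The Clarke tangent cone to a subset `S` of a normed space at `x₀`: the vectors `v` such that for
every `ε > 0` there are `δ > 0` and `l > 0` for which `S ∩ (x + t (v + ε 𝔹))` is nonempty for all
`x ∈ S ∩ (x₀ + δ 𝔹)` and all `t ∈ [0, l]`, where `𝔹` is the closed unit ball. -/
def clarkeTangentCone {X : Type*} [NormedAddCommGroup X] [NormedSpace ℝ X]
    (S : Set X) (x₀ : X) : Set X :=
  {v | ∀ ε : ℝ, 0 < ε → ∃ δ : ℝ, 0 < δ ∧ ∃ l : ℝ, 0 < l ∧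
    ∀ x ∈ S ∩ closedBall x₀ δ, ∀ t ∈ Set.Icc (0 : ℝ) l,
      ∃ w ∈ closedBall v ε, x + t • w ∈ S}

/-- The Clarke normal cone: the polar cone of the Clarke tangent cone, in the topological dual. -/
def clarkeNormalCone {X : Type*} [NormedAddCommGroup X] [NormedSpace ℝ X]
    (S : Set X) (x₀ : X) : Set (StrongDual ℝ X) :=
  {f | ∀ v ∈ clarkeTangentCone S x₀, f v ≤ 0}

/-- A set of functionals is weak*-closed if it is closed in the weak* topology of the dual. -/
def IsWeakStarClosed {X : Type*} [NormedAddCommGroup X] [NormedSpace ℝ X]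
    (N : Set (StrongDual ℝ X)) : Prop :=
  IsClosed {f : WeakDual ℝ X | WeakDual.toStrongDual f ∈ N}

/-- A set `A` is compactly epi-Lipschitz (massive) at its point `x₀`. -/
def IsCompactlyEpiLipschitzAt {X : Type*} [NormedAddCommGroup X] [NormedSpace ℝ X]
    (A : Set X) (x₀ : X) : Prop :=
  ∃ ε : ℝ, 0 < ε ∧ ∃ δ : ℝ, 0 < δ ∧ ∃ K : Set X, IsCompact K ∧
    ∀ x ∈ A ∩ closedBall x₀ δ, ∀ v : X, ‖v‖ ≤ ε → ∀ t ∈ Set.Icc (0 : ℝ) δ,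
      ∃ k ∈ K, x + t • (v - k) ∈ A

/-- Transversality of two closed convex cones. -/
def AreTransversalCones {X : Type*} [NormedAddCommGroup X] [NormedSpace ℝ X]
    (C₁ C₂ : Set X) : Prop :=
  ∃ ρ : ℝ, 0 < ρ ∧
    closedBall (0 : X) ρ ⊆ closure ((C₁ ∩ closedBall 0 1) - (C₂ ∩ closedBall 0 1))

/-- The real Banach space `ℓ∞(ℕ)` of bounded sequences with the supremum norm. -/
abbrev EllInfty : Type := lp (fun _ : ℕ => ℝ) ⊤

/-- The subspace `c₀(ℕ)` of `ℓ∞(ℕ)` of sequences that converge to zero. -/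
def cZero : Submodule ℝ EllInfty where
  carrier := {x | Tendsto (fun n => x n) atTop (𝓝 0)}
  add_mem' := by
    intro a b ha hb
    simpa using Tendsto.add ha hb
  zero_mem' := by simp
  smul_mem' := by
    intro c x hx
    simpa using Tendsto.const_mul c hx

/-- The set of bounded sequences `x` with `liminf |x n| ≤ 0`. -/
def liminfSet : Set EllInfty :=
  {x | liminf (fun n => |x n|) atTop ≤ 0}

/-!
Membership in `liminfSet` means that the sequence tends to zero along some ultrafilter finer than
`atTop`. Subtracting from `v` its limit along that ultrafilter, a bounded constant, gives the
compact epi-Lipschitz property with a segment of constant sequences, and the tangent cone is found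
to be `c₀` by testing `v ∉ c₀` on small sequences that vanish exactly where `v` is large.

*Existence of `B`.* It suffices to have a bounded operator `T` on `ℓ∞`, with values in `ℓ²`, that is
onto and maps `c₀` to a dense proper subspace; then `B` is its kernel (`coeffKernel`). Divide `ℕ`
into blocks, the `m`-th of which contains a copy of the cube `{±1}^m` and one further point. The
`n`-th coordinate of `T x` is the limit along an ultrafilter of the `n`-th Rademacher coefficient of
`x` on the `m`-th cube, plus `1 / (n + 1)` times the value of `x` at the further point of the `n`-th
block. By Bessel's inequality (`sum_sq_rademacher_le`) the values are in `ℓ²`. The first part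
vanishes on `c₀`, so `T` restricted to `c₀` is diagonal with dense proper range. The first part alone
is onto: for `‖a‖ ≤ 1` in `ℓ²`, the Riesz products `∏ (1 + i aₙ rₙ)` are uniformly bounded
(`norm_rieszProduct_le`) and their imaginary parts have Rademacher coefficients exactly `aₙ`
(`sum_rademacher_mul_rieszProduct`). The resulting preimages have controlled norm
(`exists_coeff_eq`), which turns density of `T c₀` into density of `c₀ + B`.

*Failure of transversality and of weak* closedness.* Let `C` and `D` be closed subspaces of a Banach
space. If they are transversal, successive approximation gives `C + D = X`
(`AreTransversalCones.sup_eq_top`). The normal cones are the annihilators; if their sum is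
weak*-closed, it is norm-closed. When `C + D` is dense, the annihilators have trivial intersection,
and the open mapping theorem bounds the components of a sum of their elements. With Hahn–Banach
extensions this yields `‖f‖ ≤ K (‖f|_C‖ + ‖f|_D‖)` for every functional `f`, hence by separation
the transversality of `C` and `D` (`areTransversalCones_of_norm_le`), and again `C + D = X`.
-/

/-! ### Annihilators and transversality of closed subspaces -/

section General

variable {X : Type*} [NormedAddCommGroup X] [NormedSpace ℝ X]

/-- The annihilator of a subspace `C` in the topological dual. -/
def annihilator (C : Submodule ℝ X) : Submodule ℝ (StrongDual ℝ X) where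
  carrier := {f | ∀ v ∈ C, f v = 0}
  add_mem' := by
    intro f g hf hg v hv
    simp [hf v hv, hg v hv]
  zero_mem' := by simp
  smul_mem' := by
    intro c f hf v hv
    simp [hf v hv]

theorem mem_annihilator {C : Submodule ℝ X} {f : StrongDual ℝ X} :
    f ∈ annihilator C ↔ ∀ v ∈ C, f v = 0 := Iff.rfl

theorem isClosed_annihilator (C : Submodule ℝ X) :
    IsClosed (annihilator C : Set (StrongDual ℝ X)) := by
  have : (annihilator C : Set (StrongDual ℝ X)) = ⋂ v ∈ C, {f | f v = 0} := by
    ext f; simp [mem_annihilator]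
  rw [this]
  exact isClosed_biInter fun v _ =>
    isClosed_eq (ContinuousLinearMap.apply ℝ ℝ v).continuous continuous_const

theorem clarkeTangentCone_submodule (B : Submodule ℝ X) (hB : IsClosed (B : Set X)) :
    clarkeTangentCone (B : Set X) 0 = B := by
  ext v
  constructor
  · intro hv
    rw [← hB.closure_eq, Metric.mem_closure_iff]
    intro ε hε
    obtain ⟨δ, hδ, l, hl, h⟩ := hv (ε / 2) (by positivity)
    obtain ⟨w, hw, hwB⟩ := h 0 ⟨B.zero_mem, by simp [hδ.le]⟩ l ⟨hl.le, le_rfl⟩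
    refine ⟨w, ?_, ?_⟩
    · simpa [B.smul_mem_iff hl.ne'] using hwB
    · rw [dist_comm]
      rw [mem_closedBall] at hw
      linarith
  · intro hv ε hε
    exact ⟨1, one_pos, 1, one_pos, fun x hx t _ =>
      ⟨v, by simp [hε.le], B.add_mem hx.1 (B.smul_mem t hv)⟩⟩

theorem clarkeNormalCone_eq_annihilator {S : Set X} {x₀ : X} {C : Submodule ℝ X}
    (h : clarkeTangentCone S x₀ = C) : clarkeNormalCone S x₀ = annihilator C := by
  ext f
  simp only [clarkeNormalCone, h, SetLike.mem_coe, Set.mem_ofPred_eq, mem_annihilator]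
  refine ⟨fun H v hv => le_antisymm (H v hv) ?_, fun H v hv => (H v hv).le⟩
  have := H (-v) (C.neg_mem hv)
  simpa using this

/-- A quantitative reading of transversality: up to halving the norm, every vector is a difference
of vectors of `C` and `D` of controlled norm. -/
theorem AreTransversalCones.exists_approx {C D : Submodule ℝ X}
    (h : AreTransversalCones (C : Set X) (D : Set X)) :
    ∃ K : ℝ, ∀ y : X, ∃ c ∈ C, ∃ d ∈ D,
      ‖c‖ ≤ K * ‖y‖ ∧ ‖d‖ ≤ K * ‖y‖ ∧ ‖y - (c - d)‖ ≤ ‖y‖ / 2 := by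
  obtain ⟨ρ, hρ, h⟩ := h
  refine ⟨ρ⁻¹, fun y => ?_⟩
  rcases eq_or_ne y 0 with rfl | hy
  · exact ⟨0, C.zero_mem, 0, D.zero_mem, by simp⟩
  have hy' : 0 < ‖y‖ := norm_pos_iff.2 hy
  have hmem : (ρ * ‖y‖⁻¹) • y ∈ closedBall (0 : X) ρ := by
    rw [mem_closedBall_zero_iff, norm_smul, Real.norm_of_nonneg (by positivity)]
    field_simp
    rfl
  obtain ⟨_, ⟨c, ⟨hc, hc1⟩, d, ⟨hd, hd1⟩, rfl⟩, hcd⟩ :=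
    Metric.mem_closure_iff.1 (h hmem) (ρ / 2) (by positivity)
  rw [mem_closedBall_zero_iff] at hc1 hd1
  have hs : ‖ρ⁻¹ * ‖y‖‖ = ρ⁻¹ * ‖y‖ := Real.norm_of_nonneg (by positivity)
  refine ⟨(ρ⁻¹ * ‖y‖) • c, C.smul_mem _ hc, (ρ⁻¹ * ‖y‖) • d, D.smul_mem _ hd, ?_, ?_, ?_⟩
  · rw [norm_smul, hs]
    exact mul_le_of_le_one_right (by positivity) hc1
  · rw [norm_smul, hs]
    exact mul_le_of_le_one_right (by positivity) hd1
  · have : y - ((ρ⁻¹ * ‖y‖) • c - (ρ⁻¹ * ‖y‖) • d)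
        = (ρ⁻¹ * ‖y‖) • ((ρ * ‖y‖⁻¹) • y - (c - d)) := by
      have h1 : (ρ⁻¹ * ‖y‖) * (ρ * ‖y‖⁻¹) = 1 := by field_simp
      rw [smul_sub, smul_smul, h1, one_smul, smul_sub]
    rw [this, norm_smul, hs, ← dist_eq_norm]
    calc ρ⁻¹ * ‖y‖ * dist ((ρ * ‖y‖⁻¹) • y) (c - d) ≤ ρ⁻¹ * ‖y‖ * (ρ / 2) := by
          gcongr
      _ = ‖y‖ / 2 := by field_simp

/-- Closed transversal subspaces of a Banach space span it: the approximate decompositions of the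
successive remainders sum up to an exact one, as in the proof of the open mapping theorem. -/
theorem AreTransversalCones.sup_eq_top [CompleteSpace X] {C D : Submodule ℝ X}
    (hC : IsClosed (C : Set X)) (hD : IsClosed (D : Set X))
    (h : AreTransversalCones (C : Set X) (D : Set X)) : C ⊔ D = ⊤ := by
  obtain ⟨K, hK⟩ := h.exists_approx
  choose c hc d hd hcK hdK hr using hK
  rw [eq_top_iff]
  intro y _
  let r : ℕ → X := fun n => (fun z => z - (c z - d z))^[n] y
  have hr_succ (n : ℕ) : r (n + 1) = r n - (c (r n) - d (r n)) :=
    Function.iterate_succ_apply' _ _ _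
  have hr_norm (n : ℕ) : ‖r n‖ ≤ ‖y‖ * (1 / 2) ^ n := by
    induction n with
    | zero => simp [r]
    | succ n ih =>
      rw [hr_succ, pow_succ]
      linarith [hr (r n)]
  have hgeom : Summable fun n : ℕ => |K| * (‖y‖ * (1 / 2) ^ n) :=
    (summable_geometric_two.mul_left _).mul_left _
  have hbound {a : X → X} (ha : ∀ z, ‖a z‖ ≤ K * ‖z‖) : Summable fun n => a (r n) := by
    refine Summable.of_norm_bounded hgeom fun n => (ha _).trans ?_
    exact mul_le_mul (le_abs_self K) (hr_norm n) (norm_nonneg _) (abs_nonneg K)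
  have hcs := (hbound hcK).hasSum
  have hds := (hbound hdK).hasSum
  have hcmem : (∑' n, c (r n)) ∈ C :=
    hC.mem_of_tendsto hcs (Eventually.of_forall fun s => C.sum_mem fun n _ => hc _)
  have hdmem : (∑' n, d (r n)) ∈ D :=
    hD.mem_of_tendsto hds (Eventually.of_forall fun s => D.sum_mem fun n _ => hd _)
  have hr0 : Tendsto r atTop (𝓝 0) := by
    refine squeeze_zero_norm hr_norm ?_
    simpa using (tendsto_pow_atTop_nhds_zero_of_lt_one (r := (1 / 2 : ℝ))
      (by norm_num) (by norm_num)).const_mul ‖y‖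
  have hsum : Tendsto (fun n => ∑ i ∈ Finset.range n, (c (r i) - d (r i))) atTop (𝓝 y) := by
    have h1 (n : ℕ) : ∑ i ∈ Finset.range n, (c (r i) - d (r i)) = y - r n := by
      have : ∀ i, c (r i) - d (r i) = r i - r (i + 1) := fun i => by rw [hr_succ]; abel
      simp_rw [this, Finset.sum_range_sub', r]
      rfl
    simp_rw [h1]
    simpa using hr0.const_sub y
  rw [tendsto_nhds_unique hsum (hcs.sub hds).tendsto_sum_nat]
  exact Submodule.sub_mem _ (Submodule.mem_sup_left hcmem) (Submodule.mem_sup_right hdmem)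

/-- A functional is at distance at most `‖f|_C‖` from the annihilator of `C`, by Hahn–Banach. -/
theorem exists_mem_annihilator_norm_sub_le (C : Submodule ℝ X) (f : StrongDual ℝ X) :
    ∃ g ∈ annihilator C, ‖f - g‖ ≤ ‖f.comp C.subtypeL‖ := by
  obtain ⟨e, he, hn⟩ := _root_.exists_extension_norm_eq C (f.comp C.subtypeL)
  refine ⟨f - e, fun v hv => ?_, ?_⟩
  · have := he ⟨v, hv⟩
    simp at this
    simp [this]
  · simp [hn]

/-- If the sum of the annihilators of `C` and `D` is closed and `C + D` is dense, then the norms of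
the restrictions of a functional to `C` and `D` control its norm. The annihilators have trivial
intersection, so the open mapping theorem bounds the components of a sum of two of their elements. -/
theorem exists_norm_le_of_isClosed_annihilator_sup {C D : Submodule ℝ X}
    (hdense : Dense ((C : Set X) + (D : Set X)))
    (hcl : IsClosed ((annihilator C : Set (StrongDual ℝ X)) + (annihilator D : Set _))) :
    ∃ K : ℝ, 0 < K ∧ ∀ f : StrongDual ℝ X,
      ‖f‖ ≤ K * (‖f.comp C.subtypeL‖ + ‖f.comp D.subtypeL‖) := by
  have : CompleteSpace (annihilator C) := (isClosed_annihilator C).completeSpace_coe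
  have : CompleteSpace (annihilator D) := (isClosed_annihilator D).completeSpace_coe
  let T : (annihilator C × annihilator D) →L[ℝ] StrongDual ℝ X :=
    (annihilator C).subtypeL.coprod (annihilator D).subtypeL
  have hT (p : annihilator C × annihilator D) : T p = p.1 + p.2 := rfl
  have hinj : Function.Injective T := by
    rw [injective_iff_map_eq_zero]
    rintro ⟨⟨m, hm⟩, ⟨n, hn⟩⟩ h
    rw [hT] at h
    have hmn : m = -n := eq_neg_of_add_eq_zero_left h
    have hm0 : m = 0 := by
      refine ContinuousLinearMap.coeFn_injective
        (Continuous.ext_on hdense m.continuous continuous_const ?_)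
      rintro _ ⟨c, hc, d, hd, rfl⟩
      have h2 : m d = 0 := by simp [hmn, mem_annihilator.1 hn d hd]
      simp [mem_annihilator.1 hm c hc, h2]
    have hn0 : n = 0 := by rw [hm0] at hmn; simpa using hmn.symm
    subst hm0 hn0
    rfl
  have hrange : IsClosed (Set.range T) := by
    convert hcl using 1
    ext f
    constructor
    · rintro ⟨⟨m, n⟩, rfl⟩
      exact ⟨m, m.2, n, n.2, rfl⟩
    · rintro ⟨m, hm, n, hn, rfl⟩
      exact ⟨(⟨m, hm⟩, ⟨n, hn⟩), rfl⟩
  obtain ⟨K, hK⟩ := ContinuousLinearMap.antilipschitz_of_injective_of_isClosed_range (𝕜 := ℝ) (E := annihilator C × annihilator D)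
      (F := StrongDual ℝ X) T hinj hrange
  refine ⟨1 + K, by positivity, fun f => ?_⟩
  obtain ⟨m, hm, hfm⟩ := exists_mem_annihilator_norm_sub_le C f
  obtain ⟨n, hn, hfn⟩ := exists_mem_annihilator_norm_sub_le D f
  have h1 : ‖m‖ ≤ K * ‖m - n‖ := by
    let p : annihilator C × annihilator D := (⟨m, hm⟩, ⟨-n, (annihilator D).neg_mem hn⟩)
    have h0 := hK.le_mul_dist p 0
    rw [map_zero, dist_zero_right (T p), hT] at h0
    have h1 : ‖m‖ ≤ dist p 0 := by
      rw [← dist_zero_right m]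
      exact le_max_left _ _
    refine h1.trans (h0.trans_eq ?_)
    simp [p, sub_eq_add_neg]
  have h2 : ‖m - n‖ ≤ ‖f.comp C.subtypeL‖ + ‖f.comp D.subtypeL‖ := by
    calc ‖m - n‖ = ‖(f - n) - (f - m)‖ := by congr 1; abel
      _ ≤ ‖f - n‖ + ‖f - m‖ := norm_sub_le _ _
      _ ≤ _ := by linarith
  have h3 : ‖f‖ ≤ ‖f - m‖ + ‖m‖ := by simpa using norm_add_le (f - m) m
  have h4 : (K : ℝ) * ‖m - n‖ ≤ K * (‖f.comp C.subtypeL‖ + ‖f.comp D.subtypeL‖) :=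
    mul_le_mul_of_nonneg_left h2 K.2
  have h5 := norm_nonneg (f.comp D.subtypeL)
  linarith

/-- A vector of small norm that is not in the closure of `(C ∩ 𝔹) - (D ∩ 𝔹)` would be separated
from it by a functional with too small restrictions to `C` and `D`. -/
theorem areTransversalCones_of_norm_le {C D : Submodule ℝ X} {K : ℝ} (hK : 0 < K)
    (h : ∀ f : StrongDual ℝ X, ‖f‖ ≤ K * (‖f.comp C.subtypeL‖ + ‖f.comp D.subtypeL‖)) :
    AreTransversalCones (C : Set X) (D : Set X) := by
  refine ⟨K⁻¹, by positivity, fun y hy => ?_⟩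
  by_contra hmem
  have hconv : Convex ℝ (closure (((C : Set X) ∩ closedBall 0 1) - ((D : Set X) ∩ closedBall 0 1))) :=
    ((C.convex.inter (convex_closedBall 0 1)).sub (D.convex.inter (convex_closedBall 0 1))).closure
  obtain ⟨f, u, hfu, huy⟩ := geometric_hahn_banach_closed_point hconv isClosed_closure hmem
  have hsep (c : X) (hc : c ∈ C) (hc1 : ‖c‖ ≤ 1) (d : X) (hd : d ∈ D) (hd1 : ‖d‖ ≤ 1) :
      f c - f d < u := by
    rw [← map_sub]
    exact hfu _ (subset_closure
      ⟨c, ⟨hc, by simpa using hc1⟩, d, ⟨hd, by simpa using hd1⟩, rfl⟩)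
  have hu : 0 < u := by
    simpa using hsep 0 C.zero_mem (by simp) 0 D.zero_mem (by simp)
  have hC (d : X) (hd : d ∈ D) (hd1 : ‖d‖ ≤ 1) : ‖f.comp C.subtypeL‖ ≤ u + f d := by
    have h0 : 0 ≤ u + f d := by
      have := hsep 0 C.zero_mem (by simp) (-d) (D.neg_mem hd) (by simpa using hd1)
      have h' := hsep 0 C.zero_mem (by simp) d hd hd1
      simp at this h'
      linarith
    refine ContinuousLinearMap.opNorm_le_of_unit_norm h0 fun c hc => ?_
    have hc' : ‖(c : X)‖ ≤ 1 := hc.le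
    have h1 := hsep c c.2 hc' d hd hd1
    have h2 := hsep (-c) (C.neg_mem c.2) (by simpa using hc') d hd hd1
    rw [map_neg] at h2
    rw [Real.norm_eq_abs]
    refine abs_le.2 ⟨?_, ?_⟩ <;> simp <;> linarith
  have hCu : ‖f.comp C.subtypeL‖ ≤ u := by simpa using hC 0 D.zero_mem (by simp)
  have hCD : ‖f.comp D.subtypeL‖ ≤ u - ‖f.comp C.subtypeL‖ := by
    refine ContinuousLinearMap.opNorm_le_of_unit_norm (by linarith) fun d hd => ?_
    have hd' : ‖(d : X)‖ ≤ 1 := hd.le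
    have h1 := hC d d.2 hd'
    have h2 := hC (-d) (D.neg_mem d.2) (by simpa using hd')
    rw [map_neg] at h2
    rw [Real.norm_eq_abs]
    refine abs_le.2 ⟨?_, ?_⟩ <;> simp <;> linarith
  have hfy : f y ≤ u := by
    calc f y ≤ ‖f‖ * ‖y‖ := (le_abs_self _).trans (f.le_opNorm y)
      _ ≤ (K * u) * K⁻¹ := by
        refine mul_le_mul ((h f).trans ?_) (by simpa using hy) (norm_nonneg _) (by positivity)
        exact mul_le_mul_of_nonneg_left (by linarith) hK.le
      _ = u := by field_simp
  linarith

/-- If closed subspaces `C` and `D` have a dense sum and the sum of their annihilators is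
weak*-closed, then `C + D` is the whole space. -/
theorem sup_eq_top_of_isWeakStarClosed [CompleteSpace X] {C D : Submodule ℝ X}
    (hC : IsClosed (C : Set X)) (hD : IsClosed (D : Set X))
    (hdense : Dense ((C : Set X) + (D : Set X)))
    (h : IsWeakStarClosed ((annihilator C : Set (StrongDual ℝ X)) + (annihilator D : Set _))) :
    C ⊔ D = ⊤ := by
  have hcl : IsClosed ((annihilator C : Set (StrongDual ℝ X)) + (annihilator D : Set _)) :=
    IsClosed.preimage NormedSpace.Dual.toWeakDual_continuous h
  obtain ⟨K, hK, hle⟩ := exists_norm_le_of_isClosed_annihilator_sup hdense hcl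
  exact (areTransversalCones_of_norm_le hK hle).sup_eq_top hC hD

end General

/-! ### The tangent cone of the set of sequences with `liminf |x n| ≤ 0` -/

theorem EllInfty.abs_apply_le (x : EllInfty) (n : ℕ) : |x n| ≤ ‖x‖ :=
  lp.norm_apply_le_norm ENNReal.top_ne_zero x n

theorem EllInfty.norm_le {x : EllInfty} {C : ℝ} (hC : 0 ≤ C) (h : ∀ n, |x n| ≤ C) : ‖x‖ ≤ C :=
  lp.norm_le_of_forall_le hC h

/-- The bounded sequence with the given terms. -/
def EllInfty.ofBounded (f : ℕ → ℝ) (C : ℝ) (h : ∀ n, |f n| ≤ C) : EllInfty :=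
  ⟨f, memℓp_infty ⟨C, by rintro _ ⟨n, rfl⟩; exact h n⟩⟩

@[simp]
theorem EllInfty.ofBounded_apply (f : ℕ → ℝ) (C : ℝ) (h : ∀ n, |f n| ≤ C) (n : ℕ) :
    EllInfty.ofBounded f C h n = f n := rfl

theorem mem_liminfSet_iff_frequently {x : EllInfty} :
    x ∈ liminfSet ↔ ∀ ε : ℝ, 0 < ε → ∃ᶠ n in atTop, |x n| < ε := by
  have hbdd : IsBoundedUnder (· ≤ ·) atTop fun n => |x n| :=
    isBoundedUnder_of ⟨‖x‖, x.abs_apply_le⟩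
  have hbdd' : IsBoundedUnder (· ≥ ·) atTop fun n => |x n| :=
    isBoundedUnder_of ⟨0, fun n => abs_nonneg _⟩
  constructor
  · intro h ε hε
    exact frequently_lt_of_liminf_lt (hbdd.isCoboundedUnder_flip) (lt_of_le_of_lt h hε)
  · intro h
    change liminf (fun n => |x n|) atTop ≤ 0
    refine le_of_forall_pos_le_add fun ε hε => ?_
    rw [zero_add]
    exact liminf_le_of_frequently_le ((h ε hε).mono fun n hn => hn.le) hbdd'

theorem mem_liminfSet_iff_ultrafilter {x : EllInfty} :
    x ∈ liminfSet ↔ ∃ U : Ultrafilter ℕ, ↑U ≤ (atTop : Filter ℕ) ∧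
      Tendsto (fun n => x n) U (𝓝 0) := by
  rw [← mapClusterPt_iff_ultrafilter, Metric.nhds_basis_ball.mapClusterPt_iff_frequently,
    mem_liminfSet_iff_frequently]
  simp

theorem isClosed_liminfSet : IsClosed liminfSet := by
  refine isClosed_of_closure_subset fun x hx => ?_
  rw [mem_liminfSet_iff_frequently]
  intro ε hε
  obtain ⟨y, hy, hxy⟩ := Metric.mem_closure_iff.1 hx (ε / 2) (by positivity)
  refine (mem_liminfSet_iff_frequently.1 hy (ε / 2) (by positivity)).mono fun n hn => ?_
  have h1 := (x - y).abs_apply_le n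
  rw [← dist_eq_norm] at h1
  have h2 : |x n| ≤ |x n - y n| + |y n| := by simpa using abs_add_le (x n - y n) (y n)
  have h3 : (x - y) n = x n - y n := rfl
  rw [h3] at h1
  linarith

theorem zero_mem_liminfSet : (0 : EllInfty) ∈ liminfSet := by
  rw [mem_liminfSet_iff_frequently]
  intro ε hε
  simpa using hε

/-- The compact set is a segment of constant sequences: along an ultrafilter on which `x` tends to
zero, `v` has some limit `c`, and `x + t • (v - c)` still tends to zero. -/
theorem isCompactlyEpiLipschitzAt_liminfSet : IsCompactlyEpiLipschitzAt liminfSet 0 := by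
  refine ⟨1, one_pos, 1, one_pos, (fun c : ℝ => c • (1 : EllInfty)) '' Set.Icc (-1) 1,
    isCompact_Icc.image (by fun_prop), ?_⟩
  rintro x ⟨hx, -⟩ v hv t -
  obtain ⟨U, hU, hxU⟩ := mem_liminfSet_iff_ultrafilter.1 hx
  obtain ⟨c, hc, hvc⟩ := (isCompact_Icc (a := (-1 : ℝ)) (b := 1)).ultrafilter_le_nhds
    (U.map fun n : ℕ => v n) (by
      rw [le_principal_iff]
      change ∀ᶠ n in (U : Filter ℕ), v n ∈ Set.Icc (-1 : ℝ) 1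
      exact Eventually.of_forall fun n => abs_le.1 ((v.abs_apply_le n).trans hv))
  refine ⟨_, ⟨c, hc, rfl⟩, mem_liminfSet_iff_ultrafilter.2 ⟨U, hU, ?_⟩⟩
  have hvc' : Tendsto (fun n => v n) U (𝓝 c) := hvc
  have := hxU.add ((hvc'.sub_const c).const_mul t)
  have h1 (n : ℕ) : (x + t • (v - c • (1 : EllInfty))) n = x n + t * (v n - c) := by
    have : (x + t • (v - c • (1 : EllInfty))) n = x n + t * (v n - c * 1) := rfl
    rw [this, mul_one]
  simp only [h1]
  simpa using this

theorem clarkeTangentCone_liminfSet :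
    clarkeTangentCone liminfSet 0 = (cZero : Set EllInfty) := by
  ext v
  constructor
  · intro hv
    by_contra hv0
    have hv0' : ¬ Tendsto (fun n => v n) atTop (𝓝 0) := hv0
    rw [Metric.nhds_basis_ball.tendsto_right_iff] at hv0'
    push Not at hv0'
    obtain ⟨ε, hε, hfreq⟩ := hv0'
    obtain ⟨δ, hδ, l, hl, h⟩ := hv (ε / 2) (by positivity)
    -- `x` vanishes exactly where `v` is large, and is bounded below elsewhere; a step `t` small
    -- with respect to `δ` then moves both kinds of terms away from zero.
    let x : EllInfty := EllInfty.ofBounded (fun n => if ε ≤ |v n| then 0 else δ) δ (by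
      intro n
      dsimp only
      split_ifs <;> simp [abs_of_pos hδ, hδ.le])
    have hx : x ∈ liminfSet := by
      rw [mem_liminfSet_iff_frequently]
      intro η hη
      refine hfreq.mono fun n hn => ?_
      have hn' : ε ≤ |v n| := by simpa using hn
      simpa [x, hn'] using hη
    have hxδ : x ∈ closedBall (0 : EllInfty) δ := by
      rw [mem_closedBall_zero_iff]
      refine EllInfty.norm_le hδ.le fun n => ?_
      simp only [x, EllInfty.ofBounded_apply]
      split_ifs <;> simp [abs_of_pos hδ, hδ.le]
    have hM : 0 < ‖v‖ + ε / 2 := by positivity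
    let t : ℝ := min l (δ / (2 * (‖v‖ + ε / 2)))
    have ht : 0 < t := lt_min hl (by positivity)
    have htδ : t * (‖v‖ + ε / 2) ≤ δ / 2 := by
      calc t * (‖v‖ + ε / 2) ≤ δ / (2 * (‖v‖ + ε / 2)) * (‖v‖ + ε / 2) := by
            gcongr
            exact min_le_right _ _
        _ = δ / 2 := by field_simp
    obtain ⟨w, hw, hmem⟩ := h x ⟨hx, hxδ⟩ t ⟨ht.le, min_le_left _ _⟩
    rw [mem_closedBall, dist_eq_norm] at hw
    obtain ⟨n, hn⟩ := (mem_liminfSet_iff_frequently.1 hmem (min (t * (ε / 2)) (δ / 2))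
      (by positivity)).exists
    obtain ⟨hn1, hn2⟩ := lt_min_iff.1 hn
    have hxw : (x + t • w) n = (if ε ≤ |v n| then 0 else δ) + t * w n := rfl
    have hwv : |w n - v n| ≤ ε / 2 := ((w - v).abs_apply_le n).trans hw
    have hwv' := abs_le.1 hwv
    rw [hxw] at hn1 hn2
    split_ifs at hn1 hn2 with hvn
    · have : ε / 2 ≤ |w n| := by
        have := abs_sub_abs_le_abs_sub (v n) (w n)
        rw [abs_sub_comm] at this
        linarith
      rw [zero_add, abs_mul, abs_of_pos ht] at hn1
      exact absurd (mul_le_mul_of_nonneg_left this ht.le) (not_le.2 hn1)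
    · have hwn : |w n| ≤ ‖v‖ + ε / 2 := by
        have h1 := abs_sub_abs_le_abs_sub (w n) (v n)
        have h2 := v.abs_apply_le n
        linarith
      have h3 : |t * w n| ≤ δ / 2 := by
        rw [abs_mul, abs_of_pos ht]
        exact (mul_le_mul_of_nonneg_left hwn ht.le).trans htδ
      have h4 := neg_le_of_abs_le h3
      have h5 := (abs_lt.1 hn2).2
      linarith
  · intro hv ε hε
    refine ⟨1, one_pos, 1, one_pos, fun x hx t _ => ⟨v, by simp [hε.le], ?_⟩⟩
    obtain ⟨U, hU, hxU⟩ := mem_liminfSet_iff_ultrafilter.1 hx.1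
    refine mem_liminfSet_iff_ultrafilter.2 ⟨U, hU, ?_⟩
    have hv' : Tendsto (fun n => v n) atTop (𝓝 0) := hv
    have h := hxU.add ((hv'.mono_left hU).const_mul t)
    rw [mul_zero, add_zero] at h
    exact h

theorem isClosed_cZero : IsClosed (cZero : Set EllInfty) := by
  refine isClosed_of_closure_subset fun x hx => ?_
  change Tendsto (fun n => x n) atTop (𝓝 0)
  rw [Metric.tendsto_nhds]
  intro ε hε
  obtain ⟨y, hy, hxy⟩ := Metric.mem_closure_iff.1 hx (ε / 2) (by positivity)
  have hy' : Tendsto (fun n => y n) atTop (𝓝 0) := hy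
  filter_upwards [Metric.tendsto_nhds.1 hy' (ε / 2) (by positivity)] with n hn
  have h1 : |x n - y n| ≤ ‖x - y‖ := (x - y).abs_apply_le n
  rw [← dist_eq_norm] at h1
  have h2 : |x n| ≤ |x n - y n| + |y n| := by simpa using abs_add_le (x n - y n) (y n)
  rw [Real.dist_eq, sub_zero] at hn ⊢
  linarith

/-! ### Rademacher functions on finite cubes -/

/-- The `n`-th Rademacher function on the cube of finite sets of natural numbers: the sign of the
`n`-th coordinate. -/
def rademacher (n : ℕ) (s : Finset ℕ) : ℝ := if n ∈ s then -1 else 1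

theorem rademacher_mul_self (n : ℕ) (s : Finset ℕ) : rademacher n s * rademacher n s = 1 := by
  unfold rademacher; split_ifs <;> norm_num

theorem abs_rademacher (n : ℕ) (s : Finset ℕ) : |rademacher n s| = 1 := by
  unfold rademacher; split_ifs <;> norm_num

theorem sum_rademacher_mul_of_ne {m i j : ℕ} (hi : i < m) (hij : i ≠ j) :
    ∑ s ∈ (Finset.range m).powerset, rademacher i s * rademacher j s = 0 := by
  -- Flipping the `i`-th coordinate changes the sign of the summand.
  have hmem (s : Finset ℕ) (k : ℕ) : k ∈ symmDiff s {i} ↔ (k ∈ s ↔ k ≠ i) := by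
    simp only [Finset.mem_symmDiff, Finset.mem_singleton]
    tauto
  have hi' (s : Finset ℕ) : rademacher i (symmDiff s {i}) = -rademacher i s := by
    by_cases h : i ∈ s <;> simp [rademacher, hmem, h]
  have hj' (s : Finset ℕ) : rademacher j (symmDiff s {i}) = rademacher j s := by
    by_cases h : j ∈ s <;> simp [rademacher, hmem, h, hij.symm]
  refine Finset.sum_involution (fun s _ => symmDiff s {i}) ?_ ?_ ?_ ?_
  · intro s _
    rw [hi', hj']
    ring
  · intro s _ _ h
    have h1 := hi' s
    rw [h] at h1
    have h2 := rademacher_mul_self i s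
    have h3 : rademacher i s = 0 := by linarith
    simp [h3] at h2
  · intro s hs
    rw [Finset.mem_powerset] at hs ⊢
    intro k hk
    rcases eq_or_ne k i with rfl | hki
    · simpa using hi
    · exact hs (((hmem s k).1 hk).2 hki)
  · intro s _
    simp

theorem sum_rademacher_mul {m i j : ℕ} (hi : i < m) :
    ∑ s ∈ (Finset.range m).powerset, rademacher i s * rademacher j s
      = if i = j then 2 ^ m else 0 := by
  split_ifs with h
  · subst h
    simp [rademacher_mul_self]
  · exact sum_rademacher_mul_of_ne hi h

/-- Bessel's inequality for the Rademacher functions on the `m`-dimensional cube. -/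
theorem sum_sq_rademacher_le {m N : ℕ} (hN : N ≤ m) (f : Finset ℕ → ℝ) {C : ℝ}
    (hf : ∀ s, |f s| ≤ C) :
    ∑ n ∈ Finset.range N,
      ((2 ^ m)⁻¹ * ∑ s ∈ (Finset.range m).powerset, rademacher n s * f s) ^ 2 ≤ C ^ 2 := by
  set c : ℕ → ℝ := fun n => (2 ^ m)⁻¹ * ∑ s ∈ (Finset.range m).powerset, rademacher n s * f s
  have hc (n : ℕ) : ∑ s ∈ (Finset.range m).powerset, rademacher n s * f s = 2 ^ m * c n := by
    simp [c]
  have h0 : 0 ≤ ∑ s ∈ (Finset.range m).powerset,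
      (f s - ∑ n ∈ Finset.range N, c n * rademacher n s) ^ 2 :=
    Finset.sum_nonneg fun s _ => sq_nonneg _
  have h1 : ∑ s ∈ (Finset.range m).powerset, f s * ∑ n ∈ Finset.range N, c n * rademacher n s
      = 2 ^ m * ∑ n ∈ Finset.range N, c n ^ 2 := by
    simp_rw [Finset.mul_sum]
    rw [Finset.sum_comm]
    refine Finset.sum_congr rfl fun n _ => ?_
    rw [pow_two, mul_left_comm, ← hc n, Finset.mul_sum]
    exact Finset.sum_congr rfl fun s _ => by ring
  have h2 : ∑ s ∈ (Finset.range m).powerset, (∑ n ∈ Finset.range N, c n * rademacher n s) ^ 2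
      = 2 ^ m * ∑ n ∈ Finset.range N, c n ^ 2 := by
    simp_rw [pow_two, Finset.sum_mul_sum]
    rw [Finset.sum_comm, Finset.mul_sum]
    refine Finset.sum_congr rfl fun n hn => ?_
    rw [Finset.sum_comm]
    have hnm : n < m := (Finset.mem_range.1 hn).trans_le hN
    have (k : ℕ) : ∑ s ∈ (Finset.range m).powerset,
        c n * rademacher n s * (c k * rademacher k s) = if n = k then 2 ^ m * (c n * c n) else 0 := by
      have : ∀ s, c n * rademacher n s * (c k * rademacher k s)
        = c n * c k * (rademacher n s * rademacher k s) := fun s => by ring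
      simp_rw [this, ← Finset.mul_sum, sum_rademacher_mul hnm]
      split_ifs with h
      · subst h; ring
      · simp
    simp_rw [this]
    rw [Finset.sum_ite_eq, if_pos hn]
  have h3 : ∑ s ∈ (Finset.range m).powerset, f s ^ 2 ≤ 2 ^ m * C ^ 2 := by
    refine (Finset.sum_le_card_nsmul _ _ (C ^ 2) fun s _ => ?_).trans_eq ?_
    · exact sq_le_sq' (neg_le_of_abs_le (hf s)) (le_of_abs_le (hf s))
    · simp
  have h4 : ∑ s ∈ (Finset.range m).powerset,
      (f s - ∑ n ∈ Finset.range N, c n * rademacher n s) ^ 2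
      = ∑ s ∈ (Finset.range m).powerset, f s ^ 2 - 2 ^ m * ∑ n ∈ Finset.range N, c n ^ 2 := by
    simp_rw [sub_sq, Finset.sum_add_distrib, Finset.sum_sub_distrib, mul_assoc, ← Finset.mul_sum]
    rw [h1, h2]
    ring
  rw [h4] at h0
  have h5 : (2 : ℝ) ^ m * ∑ n ∈ Finset.range N, c n ^ 2 ≤ 2 ^ m * C ^ 2 := by linarith
  exact le_of_mul_le_mul_left h5 (by positivity)

/-! ### Riesz products -/

/-- The Riesz product `∏ (1 + i aₙ rₙ)` over `n < m`, where `rₙ` is the `n`-th Rademacher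
function. -/
def rieszProduct (a : ℕ → ℝ) (m : ℕ) (s : Finset ℕ) : ℂ :=
  ∏ n ∈ Finset.range m, (1 + (a n * rademacher n s : ℝ) * Complex.I)

/-- The factors have modulus `√(1 + aₙ²)`, so the product is bounded by `exp (∑ aₙ² / 2)`. -/
theorem norm_rieszProduct_le {a : ℕ → ℝ} {m : ℕ} (ha : ∑ n ∈ Finset.range m, a n ^ 2 ≤ 1)
    (s : Finset ℕ) : ‖rieszProduct a m s‖ ≤ 2 := by
  have h1 : ‖rieszProduct a m s‖ ^ 2 ≤ 2 ^ 2 := by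
    have hfac (n : ℕ) : ‖(1 + (a n * rademacher n s : ℝ) * Complex.I : ℂ)‖ ^ 2 = 1 + a n ^ 2 := by
      have h2 : (1 + (a n * rademacher n s : ℝ) * Complex.I : ℂ)
          = ((1 : ℝ) : ℂ) + ((a n * rademacher n s : ℝ) : ℂ) * Complex.I := by simp
      rw [h2, ← Complex.normSq_eq_norm_sq, Complex.normSq_add_mul_I, mul_pow,
        pow_two (rademacher n s), rademacher_mul_self]
      ring
    calc ‖rieszProduct a m s‖ ^ 2 = ∏ n ∈ Finset.range m, (1 + a n ^ 2) := by
          rw [rieszProduct, norm_prod, ← Finset.prod_pow]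
          exact Finset.prod_congr rfl fun n _ => hfac n
      _ ≤ ∏ n ∈ Finset.range m, Real.exp (a n ^ 2) := by
          refine Finset.prod_le_prod (fun n _ => by positivity) fun n _ => ?_
          rw [add_comm]
          exact Real.add_one_le_exp _
      _ = Real.exp (∑ n ∈ Finset.range m, a n ^ 2) := (Real.exp_sum _ _).symm
      _ ≤ Real.exp 1 := Real.exp_le_exp.2 ha
      _ ≤ 2 ^ 2 := by linarith [Real.exp_one_lt_d9]
  exact le_of_sq_le_sq h1 (by norm_num)

/-- The Rademacher coefficients of a Riesz product: expanding the product over the coordinates, all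
factors but the `n`-th average to one. -/
theorem sum_rademacher_mul_rieszProduct (a : ℕ → ℝ) {m n : ℕ} (hn : n < m) :
    ∑ s ∈ (Finset.range m).powerset, (rademacher n s : ℂ) * rieszProduct a m s
      = 2 ^ m * (a n * Complex.I) := by
  have hn' : n ∈ Finset.range m := Finset.mem_range.2 hn
  let u : ℕ → ℂ := fun j => (if j = n then -1 else 1) * (1 - a j * Complex.I)
  let v : ℕ → ℂ := fun j => 1 + a j * Complex.I
  have hterm : ∀ s ∈ (Finset.range m).powerset, (rademacher n s : ℂ) * rieszProduct a m s
      = (∏ j ∈ s, u j) * ∏ j ∈ Finset.range m \ s, v j := by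
    intro s hs
    have hs' := Finset.mem_powerset.1 hs
    have h1 : (rademacher n s : ℂ) = ∏ j ∈ s, (if j = n then (-1 : ℂ) else 1) := by
      rw [Finset.prod_ite_eq']
      unfold rademacher
      split_ifs <;> simp
    have h2 : ∏ j ∈ Finset.range m \ s, (1 + (a j * rademacher j s : ℝ) * Complex.I)
        = ∏ j ∈ Finset.range m \ s, v j := by
      refine Finset.prod_congr rfl fun j hj => ?_
      simp [rademacher, v, (Finset.mem_sdiff.1 hj).2]
    have h3 : ∏ j ∈ s, (1 + (a j * rademacher j s : ℝ) * Complex.I)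
        = ∏ j ∈ s, (1 - a j * Complex.I) := by
      refine Finset.prod_congr rfl fun j hj => ?_
      simp [rademacher, hj, sub_eq_add_neg]
    rw [rieszProduct, ← Finset.prod_sdiff hs', h2, h3, h1, Finset.prod_mul_distrib]
    ring
  rw [Finset.sum_congr rfl hterm, ← Finset.prod_add, ← Finset.mul_prod_erase _ _ hn']
  have h4 : ∏ j ∈ (Finset.range m).erase n, (u j + v j) = 2 ^ (m - 1) := by
    rw [Finset.prod_congr rfl (g := fun _ => (2 : ℂ)), Finset.prod_const, Finset.card_erase_of_mem hn',
      Finset.card_range]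
    intro j hj
    simp only [u, v, if_neg (Finset.ne_of_mem_erase hj)]
    ring
  have h5 : (2 : ℂ) ^ m = 2 * 2 ^ (m - 1) := by
    rw [← pow_succ', Nat.sub_add_cancel (by omega)]
  rw [h4, h5]
  simp only [u, v, if_true]
  ring

/-! ### A closed subspace whose sum with `c₀` is dense and proper -/

/-- The position in a sequence of the vertex `s` of the `m`-dimensional cube, where `s ⊆ range m`.
Positions with `s = {m}`, which is not a vertex of that cube, serve to define `diagCoeff`. -/
def cubeIndex (m : ℕ) (s : Finset ℕ) : ℕ := Nat.pair m (Encodable.encode s)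

theorem le_cubeIndex (m : ℕ) (s : Finset ℕ) : m ≤ cubeIndex m s := Nat.left_le_pair _ _

theorem cubeIndex_inj {m n : ℕ} {s t : Finset ℕ} :
    cubeIndex m s = cubeIndex n t ↔ m = n ∧ s = t := by
  simp [cubeIndex, Nat.pair_eq_pair]

/-- The coefficient on the `n`-th Rademacher function of the `m`-th block of a sequence. -/
noncomputable def blockCoeff (n m : ℕ) : EllInfty →ₗ[ℝ] ℝ where
  toFun x := (2 ^ m)⁻¹ * ∑ s ∈ (Finset.range m).powerset, rademacher n s * x (cubeIndex m s)
  map_add' x y := by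
    simp only [lp.coeFn_add, Pi.add_apply, mul_add, Finset.sum_add_distrib]
  map_smul' c x := by
    simp only [lp.coeFn_smul, Pi.smul_apply, smul_eq_mul, RingHom.id_apply, Finset.mul_sum]
    exact Finset.sum_congr rfl fun s _ => by ring

theorem blockCoeff_apply (n m : ℕ) (x : EllInfty) : blockCoeff n m x
    = (2 ^ m)⁻¹ * ∑ s ∈ (Finset.range m).powerset, rademacher n s * x (cubeIndex m s) := rfl

/-- The `n`-th coefficient of a diagonal operator from `ℓ∞` to `ℓ²`. -/
noncomputable def diagCoeff (n : ℕ) : EllInfty →ₗ[ℝ] ℝ where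
  toFun x := x (cubeIndex n {n}) / (n + 1)
  map_add' x y := by
    simp only [lp.coeFn_add, Pi.add_apply, add_div]
  map_smul' c x := by
    simp only [lp.coeFn_smul, Pi.smul_apply, smul_eq_mul, RingHom.id_apply, mul_div_assoc]

theorem diagCoeff_apply (n : ℕ) (x : EllInfty) :
    diagCoeff n x = x (cubeIndex n {n}) / (n + 1) := rfl

theorem abs_blockCoeff_le {n m : ℕ} {x : EllInfty} {C : ℝ}
    (h : ∀ s, |x (cubeIndex m s)| ≤ C) : |blockCoeff n m x| ≤ C := by
  have h1 : |∑ s ∈ (Finset.range m).powerset, rademacher n s * x (cubeIndex m s)| ≤ 2 ^ m * C := by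
    refine (Finset.abs_sum_le_sum_abs _ _).trans
      ((Finset.sum_le_card_nsmul _ _ C fun s _ => ?_).trans_eq (by simp))
    rw [abs_mul, abs_rademacher, one_mul]
    exact h s
  rw [blockCoeff_apply, abs_mul, abs_of_nonneg (by positivity)]
  calc ((2 : ℝ) ^ m)⁻¹ * |∑ s ∈ (Finset.range m).powerset, rademacher n s * x (cubeIndex m s)|
      ≤ (2 ^ m)⁻¹ * (2 ^ m * C) := by gcongr
    _ = C := by field_simp

theorem abs_diagCoeff_le (n : ℕ) (x : EllInfty) : |diagCoeff n x| ≤ ‖x‖ / (n + 1) := by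
  have h : (0 : ℝ) < n + 1 := by positivity
  rw [diagCoeff_apply, abs_div, abs_of_pos h]
  gcongr
  exact x.abs_apply_le _

theorem tendsto_blockCoeff_of_mem_cZero {x : EllInfty} (hx : x ∈ cZero) (n : ℕ) :
    Tendsto (fun m => blockCoeff n m x) atTop (𝓝 0) := by
  have hx' : Tendsto (fun n => x n) atTop (𝓝 0) := hx
  rw [Metric.tendsto_atTop] at hx' ⊢
  intro ε hε
  obtain ⟨M, hM⟩ := hx' (ε / 2) (by positivity)
  refine ⟨M, fun m hm => ?_⟩
  have : |blockCoeff n m x| ≤ ε / 2 := abs_blockCoeff_le fun s => by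
    simpa using (hM _ (hm.le.trans (le_cubeIndex m s))).le
  rw [Real.dist_eq, sub_zero]
  linarith

/-- The limits of `coeff n m` as `m` tends to infinity along an ultrafilter are the coordinates of
an operator from `ℓ∞` to `ℓ²`. -/
noncomputable def coeff (n m : ℕ) : EllInfty →ₗ[ℝ] ℝ := blockCoeff n m + diagCoeff n

theorem coeff_apply (n m : ℕ) (x : EllInfty) :
    coeff n m x = blockCoeff n m x + diagCoeff n x := rfl

theorem abs_coeff_le (n m : ℕ) (x : EllInfty) : |coeff n m x| ≤ 2 * ‖x‖ := by
  have h1 : |blockCoeff n m x| ≤ ‖x‖ := abs_blockCoeff_le fun s => x.abs_apply_le _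
  have h2 : ‖x‖ / (n + 1) ≤ ‖x‖ := div_le_self (norm_nonneg x) (by simp)
  have h3 := abs_diagCoeff_le n x
  have h4 := abs_add_le (blockCoeff n m x) (diagCoeff n x)
  rw [coeff_apply]
  linarith

theorem tendsto_coeff_of_mem_cZero {x : EllInfty} (hx : x ∈ cZero) (n : ℕ) :
    Tendsto (fun m => coeff n m x) (hyperfilter ℕ) (𝓝 (diagCoeff n x)) := by
  have h := ((tendsto_blockCoeff_of_mem_cZero hx n).mono_left
    Nat.hyperfilter_le_atTop).add_const (diagCoeff n x)
  rw [zero_add] at h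
  exact h

theorem exists_tendsto_coeff (x : EllInfty) (n : ℕ) :
    ∃ a, Tendsto (fun m => coeff n m x) (hyperfilter ℕ) (𝓝 a) := by
  obtain ⟨a, -, ha⟩ := (isCompact_Icc (a := -(2 * ‖x‖)) (b := 2 * ‖x‖)).ultrafilter_le_nhds
    ((hyperfilter ℕ).map fun m => coeff n m x) (by
      rw [le_principal_iff]
      change ∀ᶠ m in (hyperfilter ℕ : Filter ℕ), coeff n m x ∈ Set.Icc (-(2 * ‖x‖)) (2 * ‖x‖)
      exact Eventually.of_forall fun m => abs_le.1 (abs_coeff_le n m x))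
  exact ⟨a, ha⟩

theorem summable_one_div_add_one_sq : Summable fun n : ℕ => (1 / (n + 1 : ℝ)) ^ 2 := by
  have := (summable_nat_add_iff 1).2 (Real.summable_one_div_nat_pow.2 (one_lt_two))
  simpa using this

/-- The limits of the coefficients of a bounded sequence are square-summable. -/
theorem summable_sq_of_tendsto_coeff {x : EllInfty} {a : ℕ → ℝ}
    (ha : ∀ n, Tendsto (fun m => coeff n m x) (hyperfilter ℕ) (𝓝 (a n))) :
    Summable fun n => a n ^ 2 := by
  set Z : ℝ := ∑' n : ℕ, (1 / (n + 1 : ℝ)) ^ 2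
  refine summable_of_sum_range_le (c := 2 * (‖x‖ ^ 2 + ‖x‖ ^ 2 * Z)) (fun n => sq_nonneg _)
    fun N => ?_
  refine le_of_tendsto (tendsto_finsetSum (Finset.range N) fun n _ => (ha n).pow 2) ?_
  filter_upwards [(eventually_ge_atTop N).filter_mono Nat.hyperfilter_le_atTop] with m hm
  have h1 : ∑ n ∈ Finset.range N, blockCoeff n m x ^ 2 ≤ ‖x‖ ^ 2 :=
    sum_sq_rademacher_le hm (fun s => x (cubeIndex m s)) fun s => x.abs_apply_le _
  have h2 : ∑ n ∈ Finset.range N, diagCoeff n x ^ 2 ≤ ‖x‖ ^ 2 * Z := by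
    calc ∑ n ∈ Finset.range N, diagCoeff n x ^ 2
        ≤ ∑ n ∈ Finset.range N, ‖x‖ ^ 2 * (1 / (n + 1 : ℝ)) ^ 2 := by
          refine Finset.sum_le_sum fun n _ => ?_
          rw [← mul_pow, mul_one_div, ← sq_abs]
          exact pow_le_pow_left₀ (abs_nonneg _) (abs_diagCoeff_le n x) 2
      _ = ‖x‖ ^ 2 * ∑ n ∈ Finset.range N, (1 / (n + 1 : ℝ)) ^ 2 := by rw [Finset.mul_sum]
      _ ≤ ‖x‖ ^ 2 * Z := by
          gcongr
          exact summable_one_div_add_one_sq.sum_le_tsum _ fun n _ => sq_nonneg _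
  calc ∑ n ∈ Finset.range N, coeff n m x ^ 2
      ≤ ∑ n ∈ Finset.range N, 2 * (blockCoeff n m x ^ 2 + diagCoeff n x ^ 2) :=
        Finset.sum_le_sum fun n _ => add_sq_le
    _ = 2 * (∑ n ∈ Finset.range N, blockCoeff n m x ^ 2
          + ∑ n ∈ Finset.range N, diagCoeff n x ^ 2) := by
        rw [← Finset.mul_sum, Finset.sum_add_distrib]
    _ ≤ _ := by linarith

/-- Every square-summable sequence is the sequence of coefficients of a bounded sequence of
comparable norm, built from imaginary parts of Riesz products. -/
theorem exists_coeff_eq {a : ℕ → ℝ} {η : ℝ} (hη : 0 < η)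
    (ha : ∀ N, ∑ n ∈ Finset.range N, a n ^ 2 ≤ η ^ 2) :
    ∃ x : EllInfty, ‖x‖ ≤ 2 * η ∧ ∀ n m, n < m → coeff n m x = a n := by
  let f : ℕ → Finset ℕ → ℝ := fun m s =>
    if s ⊆ Finset.range m then η * (rieszProduct (fun n => a n / η) m s).im else 0
  have hf (m : ℕ) (s : Finset ℕ) : |f m s| ≤ 2 * η := by
    simp only [f]
    split_ifs
    · have hsum : ∑ n ∈ Finset.range m, (a n / η) ^ 2 ≤ 1 := by
        simp_rw [div_pow, ← Finset.sum_div]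
        exact div_le_one_of_le₀ (ha m) (by positivity)
      have := (Complex.abs_im_le_norm _).trans (norm_rieszProduct_le hsum s)
      rw [abs_mul, abs_of_pos hη]
      nlinarith
    · simp [hη.le]
  let x : EllInfty := EllInfty.ofBounded
    (fun j => ((Encodable.decode (α := Finset ℕ) (Nat.unpair j).2).elim 0 (f (Nat.unpair j).1)))
    (2 * η) (by
      intro j
      cases Encodable.decode (α := Finset ℕ) (Nat.unpair j).2 with
      | none => simp [hη.le]
      | some s => exact hf _ s)
  have hx (m : ℕ) (s : Finset ℕ) : x (cubeIndex m s) = f m s := by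
    simp [x, cubeIndex]
  refine ⟨x, EllInfty.norm_le (by positivity) fun j => ?_, fun n m hnm => ?_⟩
  · simp only [x, EllInfty.ofBounded_apply]
    cases Encodable.decode (α := Finset ℕ) (Nat.unpair j).2 with
    | none => simp [hη.le]
    | some s => exact hf _ s
  have hdiag : diagCoeff n x = 0 := by
    rw [diagCoeff_apply, hx]
    simp [f]
  have hblock : blockCoeff n m x = a n := by
    have h1 : ∑ s ∈ (Finset.range m).powerset, rademacher n s * x (cubeIndex m s)
        = η * (∑ s ∈ (Finset.range m).powerset,
          (rademacher n s : ℂ) * rieszProduct (fun n => a n / η) m s).im := by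
      rw [Complex.im_sum, Finset.mul_sum]
      refine Finset.sum_congr rfl fun s hs => ?_
      rw [hx, Complex.im_ofReal_mul]
      simp only [f, if_pos (Finset.mem_powerset.1 hs)]
      ring
    have h2 : ((2 : ℂ) ^ m * (((a n / η : ℝ) : ℂ) * Complex.I)).im = 2 ^ m * (a n / η) := by
      have : (2 : ℂ) ^ m = ((2 ^ m : ℝ) : ℂ) := by push_cast; rfl
      rw [this, Complex.im_ofReal_mul, Complex.im_ofReal_mul, Complex.I_im, mul_one]
    rw [blockCoeff_apply, h1, sum_rademacher_mul_rieszProduct _ hnm, h2]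
    field_simp
  rw [coeff_apply, hblock, hdiag, add_zero]

/-- Finitely supported coefficients are coefficients of sequences in `c₀`. -/
theorem exists_mem_cZero_diagCoeff_eq (a : ℕ → ℝ) (N : ℕ) :
    ∃ c ∈ cZero, ∀ n, diagCoeff n c = if n < N then a n else 0 := by
  let f : ℕ → ℝ := fun j =>
    ∑ n ∈ Finset.range N, if j = cubeIndex n {n} then (n + 1) * a n else 0
  refine ⟨EllInfty.ofBounded f (∑ n ∈ Finset.range N, |(n + 1) * a n|) fun j => ?_, ?_, fun k => ?_⟩
  · refine (Finset.abs_sum_le_sum_abs _ _).trans (Finset.sum_le_sum fun n _ => ?_)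
    split_ifs
    · exact le_rfl
    · simpa only [abs_zero] using abs_nonneg _
  · change Tendsto f atTop (𝓝 0)
    have h : Tendsto f atTop (𝓝 (∑ n ∈ Finset.range N, (0 : ℝ))) := by
      refine tendsto_finsetSum _ fun n _ => ?_
      refine Tendsto.congr' ?_ tendsto_const_nhds
      filter_upwards [eventually_gt_atTop (cubeIndex n {n})] with j hj
      rw [if_neg hj.ne']
    simpa using h
  · have hk : (k : ℝ) + 1 ≠ 0 := by positivity
    rw [diagCoeff_apply, EllInfty.ofBounded_apply]
    have : ∀ n, (cubeIndex k {k} = cubeIndex n {n}) ↔ k = n := fun n => by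
      rw [cubeIndex_inj]
      simp
    simp only [f, this, Finset.sum_ite_eq, Finset.mem_range]
    split_ifs
    · field_simp
    · simp

/-- The common kernel of the limit coefficients. -/
def coeffKernel : Submodule ℝ EllInfty where
  carrier := {x | ∀ n, Tendsto (fun m => coeff n m x) (hyperfilter ℕ) (𝓝 0)}
  add_mem' := by
    intro x y hx hy n
    simpa using (hx n).add (hy n)
  zero_mem' := by simp
  smul_mem' := by
    intro c x hx n
    simpa using (hx n).const_mul c

theorem mem_coeffKernel {x : EllInfty} : x ∈ coeffKernel ↔
    ∀ n, Tendsto (fun m => coeff n m x) (hyperfilter ℕ) (𝓝 0) := Iff.rfl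

theorem isClosed_coeffKernel : IsClosed (coeffKernel : Set EllInfty) := by
  refine isClosed_of_closure_subset fun x hx => ?_
  intro n
  rw [Metric.tendsto_nhds]
  intro ε hε
  obtain ⟨y, hy, hxy⟩ := Metric.mem_closure_iff.1 hx (ε / 4) (by positivity)
  filter_upwards [Metric.tendsto_nhds.1 (mem_coeffKernel.1 hy n) (ε / 2) (by positivity)] with m hm
  have h1 := abs_coeff_le n m (x - y)
  rw [← dist_eq_norm, map_sub] at h1
  have h2 : |coeff n m x| ≤ |coeff n m x - coeff n m y| + |coeff n m y| := by
    simpa using abs_add_le (coeff n m x - coeff n m y) (coeff n m y)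
  rw [Real.dist_eq, sub_zero] at hm ⊢
  linarith

/-- Modulo `c₀`, the coefficients of a sequence can be replaced by an `ℓ²`-small tail, which are
then the coefficients of a sequence of small norm. -/
theorem dense_cZero_add_coeffKernel :
    Dense ((cZero : Set EllInfty) + (coeffKernel : Set EllInfty)) := by
  rw [Metric.dense_iff]
  intro y ε hε
  choose a ha using exists_tendsto_coeff y
  have hsum := summable_sq_of_tendsto_coeff ha
  set η : ℝ := ε / 4
  have hη : 0 < η := by positivity
  obtain ⟨N, hN⟩ := (Metric.tendsto_atTop.1 (tendsto_sum_nat_add fun n => a n ^ 2)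
    (η ^ 2) (by positivity))
  have htail : ∑' k, a (k + N) ^ 2 ≤ η ^ 2 := by
    have := hN N le_rfl
    rw [Real.dist_eq, sub_zero] at this
    exact (le_abs_self _).trans this.le
  obtain ⟨c, hc, hcN⟩ := exists_mem_cZero_diagCoeff_eq a N
  have hbound (M : ℕ) : ∑ n ∈ Finset.range M, (if n < N then 0 else a n) ^ 2 ≤ η ^ 2 := by
    calc ∑ n ∈ Finset.range M, (if n < N then 0 else a n) ^ 2
        ≤ ∑ n ∈ Finset.range (N + M), (if n < N then 0 else a n) ^ 2 :=
          Finset.sum_le_sum_of_subset_of_nonneg (Finset.range_mono (by omega))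
            fun _ _ _ => sq_nonneg _
      _ = ∑ k ∈ Finset.range M, a (k + N) ^ 2 := by
          rw [Finset.sum_range_add]
          have : ∑ n ∈ Finset.range N, (if n < N then 0 else a n) ^ 2 = 0 :=
            Finset.sum_eq_zero fun n hn => by simp [Finset.mem_range.1 hn]
          rw [this, zero_add]
          exact Finset.sum_congr rfl fun k _ => by simp [add_comm]
      _ ≤ ∑' k, a (k + N) ^ 2 :=
          ((summable_nat_add_iff N).2 hsum).sum_le_tsum _ fun _ _ => sq_nonneg _
      _ ≤ η ^ 2 := htail
  obtain ⟨x, hx, hxa⟩ := exists_coeff_eq hη hbound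
  refine ⟨y - x, ?_, c, hc, y - c - x, ?_, by simp only; abel⟩
  · rw [mem_ball, dist_eq_norm]
    have : y - x - y = -x := by abel
    rw [this, norm_neg]
    simp only [η] at hx
    linarith
  · intro n
    have hxn : Tendsto (fun m => coeff n m x) (hyperfilter ℕ) (𝓝 (if n < N then 0 else a n)) := by
      refine Tendsto.congr' ?_ tendsto_const_nhds
      filter_upwards [(eventually_gt_atTop n).filter_mono Nat.hyperfilter_le_atTop] with m hm
      exact (hxa n m hm).symm
    have h := ((ha n).sub (tendsto_coeff_of_mem_cZero hc n)).sub hxn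
    have h0 : a n - diagCoeff n c - (if n < N then 0 else a n) = 0 := by
      rw [hcN]
      split_ifs <;> simp
    rw [h0] at h
    simpa using h

/-- A sequence with coefficients `1 / (n + 1)` is not in the sum: its component in `c₀` would take
the value one infinitely often. -/
theorem cZero_add_coeffKernel_ne_univ :
    (cZero : Set EllInfty) + (coeffKernel : Set EllInfty) ≠ Set.univ := by
  intro h
  set Z : ℝ := ∑' n : ℕ, (1 / (n + 1 : ℝ)) ^ 2
  have hZ0 : 0 ≤ Z := tsum_nonneg fun n => sq_nonneg _
  have hbound (N : ℕ) : ∑ n ∈ Finset.range N, (1 / (n + 1 : ℝ)) ^ 2 ≤ (Z + 1) ^ 2 := by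
    have h1 : ∑ n ∈ Finset.range N, (1 / (n + 1 : ℝ)) ^ 2 ≤ Z :=
      summable_one_div_add_one_sq.sum_le_tsum _ fun n _ => sq_nonneg _
    nlinarith
  obtain ⟨y, -, hy⟩ := exists_coeff_eq (a := fun n => 1 / (n + 1 : ℝ)) (by positivity) hbound
  obtain ⟨c, hc, b, hb, hcb⟩ := h.ge (Set.mem_univ y)
  have hcn (n : ℕ) : c (cubeIndex n {n}) = 1 := by
    have h1 : Tendsto (fun m => coeff n m y) (hyperfilter ℕ) (𝓝 (1 / (n + 1 : ℝ))) := by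
      refine Tendsto.congr' ?_ tendsto_const_nhds
      filter_upwards [(eventually_gt_atTop n).filter_mono Nat.hyperfilter_le_atTop] with m hm
      exact (hy n m hm).symm
    have h2 := (tendsto_coeff_of_mem_cZero hc n).add (mem_coeffKernel.1 hb n)
    simp_rw [← map_add] at h2
    have hcb' : c + b = y := hcb
    rw [hcb', add_zero] at h2
    have h3 := tendsto_nhds_unique h2 h1
    have hn : (n : ℝ) + 1 ≠ 0 := by positivity
    rw [diagCoeff_apply] at h3
    field_simp at h3
    exact h3
  have hc' : Tendsto (fun n => c n) atTop (𝓝 0) := hc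
  have h4 : Tendsto (fun n : ℕ => cubeIndex n {n}) atTop atTop :=
    tendsto_atTop_mono (fun n => le_cubeIndex n _) tendsto_id
  have h5 := hc'.comp h4
  have h6 : ((fun n => c n) ∘ fun n : ℕ => cubeIndex n {n}) = fun _ => (1 : ℝ) := funext hcn
  rw [h6] at h5
  exact one_ne_zero (tendsto_nhds_unique tendsto_const_nhds h5)

/-! ### The example -/

theorem mainTheorem11 :
    (IsClosed liminfSet ∧ (0 : EllInfty) ∈ liminfSet ∧
      IsCompactlyEpiLipschitzAt liminfSet 0 ∧
      clarkeTangentCone liminfSet 0 = (cZero : Set EllInfty)) ∧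
    (∃ B : Submodule ℝ EllInfty, IsClosed (B : Set EllInfty) ∧
      Dense ((cZero : Set EllInfty) + (B : Set EllInfty)) ∧
      (cZero : Set EllInfty) + (B : Set EllInfty) ≠ Set.univ) ∧
    (∀ B : Submodule ℝ EllInfty, IsClosed (B : Set EllInfty) →
      Dense ((cZero : Set EllInfty) + (B : Set EllInfty)) →
      (cZero : Set EllInfty) + (B : Set EllInfty) ≠ Set.univ →
      clarkeTangentCone (B : Set EllInfty) 0 = (B : Set EllInfty) ∧
      clarkeTangentCone liminfSet 0 - clarkeTangentCone (B : Set EllInfty) 0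
        = (cZero : Set EllInfty) + (B : Set EllInfty) ∧
      closure (clarkeTangentCone liminfSet 0 - clarkeTangentCone (B : Set EllInfty) 0)
        = Set.univ ∧
      clarkeTangentCone liminfSet 0 - clarkeTangentCone (B : Set EllInfty) 0 ≠ Set.univ ∧
      ¬ AreTransversalCones (clarkeTangentCone liminfSet 0)
          (clarkeTangentCone (B : Set EllInfty) 0) ∧
      ¬ IsWeakStarClosed
          (clarkeNormalCone liminfSet 0 + clarkeNormalCone (B : Set EllInfty) 0)) := by
  refine ⟨⟨isClosed_liminfSet, zero_mem_liminfSet, isCompactlyEpiLipschitzAt_liminfSet,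
    clarkeTangentCone_liminfSet⟩,
    ⟨coeffKernel, isClosed_coeffKernel, dense_cZero_add_coeffKernel,
      cZero_add_coeffKernel_ne_univ⟩, ?_⟩
  intro B hB hdense hne
  have hTB := clarkeTangentCone_submodule B hB
  have hsub : (cZero : Set EllInfty) - (B : Set EllInfty)
      = (cZero : Set EllInfty) + (B : Set EllInfty) := by
    rw [sub_eq_add_neg]
    congr 1
    ext v
    simp
  have hsup : cZero ⊔ B ≠ ⊤ := by
    intro h
    apply hne
    rw [← Submodule.coe_sup, h, Submodule.top_coe]
  rw [clarkeNormalCone_eq_annihilator clarkeTangentCone_liminfSet,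
    clarkeNormalCone_eq_annihilator hTB, clarkeTangentCone_liminfSet, hTB, hsub]
  exact ⟨rfl, rfl, hdense.closure_eq, hne,
    fun h => hsup (h.sup_eq_top isClosed_cZero hB),
    fun h => hsup (sup_eq_top_of_isWeakStarClosed isClosed_cZero hB hdense h)⟩
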